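/- Let $B$ be a real unital Banach algebra (for example $M_N(\mathbb{C})$, $N\ge 1$), not necessarily commutative, and let $\mathcal{A}$ be the space of locally integrable functions $\mathbb{R}\to B$ with the dendriform operations given by the Riemann integral, $$(f\prec g)(t)=f(t)\int_0^t g(s)\,ds,\qquad (f\succ g)(t)=\Big(\int_0^t f(s)\,ds\Big)g(t),\qquad f*g=f\prec g+f\succ g .$$ Extend these operations $\lambda$-bilinearly to formal power series $\mathcal{A}[[\lambda]]$, and adjoin a unit $\mathbf 1$ with $f\prec\mathbf 1=f$. Let $a\in\mathcal{A}$. The linear dendriform equation $$X=\mathbf 1+\lambda a\prec X$$ has a unique solution $X$ in $\mathbb{R}\mathbf 1\oplus\mathcal{A}[[\lambda]]$; it is of the form $X=\mathbf 1+x$ with $x\in\lambda\mathcal{A}[[\lambda]]$, and its logarithm $\Omega'=\log^*(X):=\sum_{m\ge 1}\frac{(-1)^{m+1}}{m}x^{*m}$ exists in the $\lambda$-adic topology. For a permutation $\sigma\in S_n$, $n\ge 1$, let $d(\sigma)$ be the number of descents of $\sigma$, i.e. of indices $1\le i\le n-1$ with $\sigma(i)>\sigma(i+1)$, and for $s>0$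 put $$\widetilde F_a(\sigma)(s)=\frac{d}{ds}\int\cdots\int_{0<u_n<\cdots<u_1<s}a(u_{\sigma(1)})\cdots a(u_{\sigma(n)})\,du_1\cdots du_n .$$ The integrand is integrable on the simplex for every $s>0$, the derivative exists for almost every $s>0$, and $\widetilde F_a(\sigma)$ is integrable on $(0,s)$ for every $s>0$. Then $$\Omega'=\sum_{n>0}\lambda^n\,\frac1n\sum_{\sigma\in S_n}\frac{(-1)^{d(\sigma)}}{\binom{n-1}{d(\sigma)}}\,\widetilde F_a(\sigma),$$ that is, the constant coefficient of $\Omega'$ is $0$ and, for every $n\ge 1$, its coefficient of $\lambda^n$ equals $\frac1n\sum_{\sigma\in S_n}\frac{(-1)^{d(\sigma)}}{\binom{n-1}{d(\sigma)}}\widetilde F_a(\sigma)(s)$ for almost every $s>0$. -/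

import Mathlib

open MeasureTheory

noncomputable section

/-- A dendriform algebra over `ℝ`: a real vector space with two bilinear operations `prec` (`≺`)
and `succ` (`≻`) subject to the three dendriform axioms. -/
class DendriformAlgebra (D : Type*) [AddCommGroup D] [Module ℝ D] where
  prec : D → D → D
  succ : D → D → D
  add_prec : ∀ a b c, prec (a + b) c = prec a c + prec b c
  prec_add : ∀ a b c, prec a (b + c) = prec a b + prec a c
  smul_prec : ∀ (r : ℝ) a b, prec (r • a) b = r • prec a b
  prec_smul : ∀ (r : ℝ) a b, prec a (r • b) = r • prec a b
  add_succ : ∀ a b c, succ (a + b) c = succ a c + succ b c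
  succ_add : ∀ a b c, succ a (b + c) = succ a b + succ a c
  smul_succ : ∀ (r : ℝ) a b, succ (r • a) b = r • succ a b
  succ_smul : ∀ (r : ℝ) a b, succ a (r • b) = r • succ a b
  prec_prec : ∀ a b c, prec (prec a b) c = prec a (prec b c + succ b c)
  succ_prec : ∀ a b c, prec (succ a b) c = succ a (prec b c)
  succ_succ : ∀ a b c, succ a (succ b c) = succ (prec a b + succ a b) c

namespace DendriformAlgebra

infixl:70 " ≺ " => DendriformAlgebra.prec
infixl:70 " ≻ " => DendriformAlgebra.succ

variable {D : Type*} [AddCommGroup D] [Module ℝ D] [DendriformAlgebra D]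

/-- The associative product `a * b = a ≺ b + a ≻ b`. -/
def star (a b : D) : D := a ≺ b + a ≻ b

/-- `starPow x n` is the `(n + 1)`-st power `x * x * ⋯ * x` for the product `star`. -/
def starPow (x : D) : ℕ → D
  | 0 => x
  | n + 1 => star (starPow x n) x

end DendriformAlgebra

/-- The augmented dendriform algebra `D ⊕ ℝ·𝟏`; the element `scalar·𝟏 + vec`. -/
@[ext] structure Augmented (D : Type*) where
  scalar : ℝ
  vec : D

namespace Augmented

open DendriformAlgebra

variable {D : Type*} [AddCommGroup D] [Module ℝ D]

/-- The element `𝟏 + x`. -/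
def onePlus (x : D) : Augmented D := ⟨1, x⟩

/-- `a ≺ X` for `a ∈ D` and `X` in the augmented algebra, with the rule `a ≺ 𝟏 = a`. -/
def precAug [DendriformAlgebra D] (a : D) (X : Augmented D) : D := X.scalar • a + a ≺ X.vec

/-- `X` solves the linear dendriform equation `X = 𝟏 + a ≺ X`. -/
def SolvesLinear [DendriformAlgebra D] (a : D) (X : Augmented D) : Prop :=
  X = onePlus (precAug a X)

/-- For a decreasing filtration `F` of `D`, the element `L` is `log^*(X)`: `X` has the form `𝟏 + x`
with `x ∈ F 1`, and the partial sums of `x - x*x/2 + x*x*x/3 - ⋯` converge to `L`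
in the topology defined by `F`. -/
def IsLogStar [DendriformAlgebra D] (F : ℕ → Submodule ℝ D) (X : Augmented D) (L : D) : Prop :=
  X.scalar = 1 ∧ X.vec ∈ F 1 ∧ ∀ p : ℕ, ∃ M : ℕ, ∀ m ≥ M,
    (∑ j ∈ Finset.range m, ((-1 : ℝ) ^ j / ((j : ℝ) + 1)) • starPow X.vec j) - L ∈ F p

end Augmented

/-- Formal power series `D[[λ]]` with coefficients in a vector space `D`;
`x n` is the coefficient of `λ ^ n`. -/
def FormalSeries (D : Type*) : Type _ := ℕ → D

namespace FormalSeries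

open DendriformAlgebra
open Finset.HasAntidiagonal (antidiagonal)

variable {D : Type*} [AddCommGroup D]

instance : AddCommGroup (FormalSeries D) := inferInstanceAs (AddCommGroup (ℕ → D))

instance [Module ℝ D] : Module ℝ (FormalSeries D) := inferInstanceAs (Module ℝ (ℕ → D))

/-- The coefficient of `λ ^ n`. -/
def coeff (n : ℕ) (x : FormalSeries D) : D := x n

/-- The monomial `λ a`. -/
def lam (a : D) : FormalSeries D := fun n => if n = 1 then a else 0

/-- The `λ`-adic filtration: the series divisible by `λ ^ p`. -/
def filtration [Module ℝ D] (p : ℕ) : Submodule ℝ (FormalSeries D) where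
  carrier := {x | ∀ n < p, coeff n x = 0}
  add_mem' := by
    intro x y hx hy n hn
    have h1 : x n = 0 := hx n hn
    have h2 : y n = 0 := hy n hn
    change x n + y n = 0
    rw [h1, h2, add_zero]
  zero_mem' := by
    intro n _
    rfl
  smul_mem' := by
    intro c x hx n hn
    have h1 : x n = 0 := hx n hn
    change c • x n = 0
    rw [h1, smul_zero]

theorem sum_assoc (n : ℕ) (f : ℕ → ℕ → ℕ → D) :
    ∑ p ∈ antidiagonal n, ∑ q ∈ antidiagonal p.1, f q.1 q.2 p.2 =
      ∑ p ∈ antidiagonal n, ∑ q ∈ antidiagonal p.2, f p.1 q.1 q.2 := by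
  simp only [Finset.sum_sigma']
  apply Finset.sum_nbij' (fun ⟨⟨_i, j⟩, ⟨k, l⟩⟩ ↦ ⟨(k, l + j), (l, j)⟩)
    (fun ⟨⟨i, _j⟩, ⟨k, l⟩⟩ ↦ ⟨(i + k, l), (i, k)⟩) <;>
    simp only [Finset.mem_sigma, Finset.HasAntidiagonal.mem_antidiagonal] <;> grind

/-- An additive map in one variable commutes with finite sums. -/
theorem map_sum_of_add {E F ι : Type*} [AddCommGroup E] [AddCommGroup F] (φ : E → F)
    (h : ∀ x y, φ (x + y) = φ x + φ y) (s : Finset ι) (g : ι → E) :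
    φ (∑ i ∈ s, g i) = ∑ i ∈ s, φ (g i) :=
  map_sum (AddMonoidHom.mk' φ h) g s

/-- `D[[λ]]` with the two operations extended `λ`-bilinearly (Cauchy products). -/
instance [Module ℝ D] [DendriformAlgebra D] : DendriformAlgebra (FormalSeries D) where
  prec x y := fun n => ∑ p ∈ antidiagonal n, x p.1 ≺ y p.2
  succ x y := fun n => ∑ p ∈ antidiagonal n, x p.1 ≻ y p.2
  add_prec a b c := by
    funext n
    change ∑ p ∈ antidiagonal n, (a p.1 + b p.1) ≺ c p.2 =
      (∑ p ∈ antidiagonal n, _) + ∑ p ∈ antidiagonal n, _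
    simp only [add_prec, Finset.sum_add_distrib]
  prec_add a b c := by
    funext n
    change ∑ p ∈ antidiagonal n, a p.1 ≺ (b p.2 + c p.2) =
      (∑ p ∈ antidiagonal n, _) + ∑ p ∈ antidiagonal n, _
    simp only [prec_add, Finset.sum_add_distrib]
  smul_prec r a b := by
    funext n
    change ∑ p ∈ antidiagonal n, (r • a p.1) ≺ b p.2 = r • ∑ p ∈ antidiagonal n, _
    simp only [smul_prec, Finset.smul_sum]
  prec_smul r a b := by
    funext n
    change ∑ p ∈ antidiagonal n, a p.1 ≺ (r • b p.2) = r • ∑ p ∈ antidiagonal n, _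
    simp only [prec_smul, Finset.smul_sum]
  add_succ a b c := by
    funext n
    change ∑ p ∈ antidiagonal n, (a p.1 + b p.1) ≻ c p.2 =
      (∑ p ∈ antidiagonal n, _) + ∑ p ∈ antidiagonal n, _
    simp only [add_succ, Finset.sum_add_distrib]
  succ_add a b c := by
    funext n
    change ∑ p ∈ antidiagonal n, a p.1 ≻ (b p.2 + c p.2) =
      (∑ p ∈ antidiagonal n, _) + ∑ p ∈ antidiagonal n, _
    simp only [succ_add, Finset.sum_add_distrib]
  smul_succ r a b := by
    funext n
    change ∑ p ∈ antidiagonal n, (r • a p.1) ≻ b p.2 = r • ∑ p ∈ antidiagonal n, _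
    simp only [smul_succ, Finset.smul_sum]
  succ_smul r a b := by
    funext n
    change ∑ p ∈ antidiagonal n, a p.1 ≻ (r • b p.2) = r • ∑ p ∈ antidiagonal n, _
    simp only [succ_smul, Finset.smul_sum]
  prec_prec a b c := by
    funext n
    change ∑ p ∈ antidiagonal n, (∑ q ∈ antidiagonal p.1, a q.1 ≺ b q.2) ≺ c p.2 =
      ∑ p ∈ antidiagonal n, a p.1 ≺ ((∑ q ∈ antidiagonal p.2, b q.1 ≺ c q.2) +
        ∑ q ∈ antidiagonal p.2, b q.1 ≻ c q.2)
    simp only [map_sum_of_add (fun z : D => z ≺ _) (fun x y => add_prec x y _),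
      ← Finset.sum_add_distrib, map_sum_of_add (fun z : D => _ ≺ z) (fun x y => prec_add _ x y)]
    rw [sum_assoc n (fun i j k => (a i ≺ b j) ≺ c k)]
    simp only [prec_prec]
  succ_prec a b c := by
    funext n
    change ∑ p ∈ antidiagonal n, (∑ q ∈ antidiagonal p.1, a q.1 ≻ b q.2) ≺ c p.2 =
      ∑ p ∈ antidiagonal n, a p.1 ≻ (∑ q ∈ antidiagonal p.2, b q.1 ≺ c q.2)
    simp only [map_sum_of_add (fun z : D => z ≺ _) (fun x y => add_prec x y _),
      map_sum_of_add (fun z : D => _ ≻ z) (fun x y => succ_add _ x y)]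
    rw [sum_assoc n (fun i j k => (a i ≻ b j) ≺ c k)]
    simp only [succ_prec]
  succ_succ a b c := by
    funext n
    change ∑ p ∈ antidiagonal n, a p.1 ≻ (∑ q ∈ antidiagonal p.2, b q.1 ≻ c q.2) =
      ∑ p ∈ antidiagonal n, ((∑ q ∈ antidiagonal p.1, a q.1 ≺ b q.2) +
        ∑ q ∈ antidiagonal p.1, a q.1 ≻ b q.2) ≻ c p.2
    simp only [← Finset.sum_add_distrib,
      map_sum_of_add (fun z : D => z ≻ _) (fun x y => add_succ x y _),
      map_sum_of_add (fun z : D => _ ≻ z) (fun x y => succ_add _ x y)]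
    rw [sum_assoc n (fun i j k => (a i ≺ b j + a i ≻ b j) ≻ c k)]
    simp only [succ_succ]

end FormalSeries

/-- The space of locally integrable functions `ℝ → B`. -/
def locInt (B : Type*) [NormedRing B] [NormedAlgebra ℝ B] : Submodule ℝ (ℝ → B) where
  carrier := {f | LocallyIntegrable f volume}
  add_mem' hf hg := hf.add hg
  zero_mem' := locallyIntegrable_zero
  smul_mem' c _ hf := hf.smul c

/-- Locally integrable functions `ℝ → B`, as a type. -/
abbrev LocIntFun (B : Type*) [NormedRing B] [NormedAlgebra ℝ B] : Type _ := ↥(locInt B)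

namespace LocIntFun

variable {B : Type*} [NormedRing B] [NormedAlgebra ℝ B]

/-- The Riemann integral operator `I(f)(t) = ∫_0^t f(s) ds`. -/
def primitive (f : LocIntFun B) (t : ℝ) : B := ∫ s in (0 : ℝ)..t, f.1 s

theorem intervalIntegrable (f : LocIntFun B) (x y : ℝ) : IntervalIntegrable f.1 volume x y :=
  ((f.2.locallyIntegrableOn (Set.uIcc x y)).integrableOn_isCompact isCompact_uIcc).intervalIntegrable

theorem primitive_continuous (f : LocIntFun B) : Continuous (primitive f) :=
  intervalIntegral.continuous_primitive (fun x y => f.intervalIntegrable x y) 0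

/-- `(f ≺ g)(t) = f(t) ∫_0^t g(s) ds`. -/
def precFun (f g : LocIntFun B) : LocIntFun B :=
  ⟨fun t => f.1 t * primitive g t, by
    have h : LocallyIntegrableOn f.1 Set.univ volume := f.2.locallyIntegrableOn _
    exact locallyIntegrableOn_univ.1
      (h.mul_continuousOn g.primitive_continuous.continuousOn isClosed_univ.isLocallyClosed)⟩

/-- `(f ≻ g)(t) = (∫_0^t f(s) ds) g(t)`. -/
def succFun (f g : LocIntFun B) : LocIntFun B :=
  ⟨fun t => primitive f t * g.1 t, by
    have h : LocallyIntegrableOn g.1 Set.univ volume := g.2.locallyIntegrableOn _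
    exact locallyIntegrableOn_univ.1
      (h.continuousOn_mul f.primitive_continuous.continuousOn isClosed_univ.isLocallyClosed)⟩

theorem primitive_add (f g : LocIntFun B) (t : ℝ) :
    primitive (f + g) t = primitive f t + primitive g t :=
  intervalIntegral.integral_add (f.intervalIntegrable 0 t) (g.intervalIntegrable 0 t)

theorem primitive_smul (r : ℝ) (f : LocIntFun B) (t : ℝ) :
    primitive (r • f) t = r • primitive f t :=
  intervalIntegral.integral_smul r f.1

theorem parts_aux {f g : ℝ → B} {t : ℝ} (ht : 0 ≤ t)
    (hf : IntegrableOn f (Set.Ioc 0 t) volume) (hg : IntegrableOn g (Set.Ioc 0 t) volume) :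
    (∫ s in (0 : ℝ)..t, f s) * (∫ s in (0 : ℝ)..t, g s) =
      (∫ s in (0 : ℝ)..t, f s * ∫ r in (0 : ℝ)..s, g r) +
        ∫ s in (0 : ℝ)..t, (∫ r in (0 : ℝ)..s, f r) * g s := by
  set μ := (volume : Measure ℝ).restrict (Set.Ioc 0 t) with hμ
  have hprod : Integrable (fun z : ℝ × ℝ => f z.1 * g z.2) (μ.prod μ) := hf.mul_prod hg
  have hS : MeasurableSet {z : ℝ × ℝ | z.2 ≤ z.1} := measurableSet_le measurable_snd measurable_fst
  have h1 := integral_add_compl hS hprod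
  have e0 : ∫ z, f z.1 * g z.2 ∂(μ.prod μ) = (∫ s, f s ∂μ) * ∫ s, g s ∂μ := by
    rw [integral_prod _ hprod]
    have : ∀ x, ∫ y, f x * g y ∂μ = f x * ∫ y, g y ∂μ := fun x =>
      integral_const_mul_of_integrable hg
    simp only [this]
    exact integral_mul_const_of_integrable hf
  have e1 : ∫ z in {z : ℝ × ℝ | z.2 ≤ z.1}, f z.1 * g z.2 ∂(μ.prod μ) =
      ∫ s in (0 : ℝ)..t, f s * ∫ r in (0 : ℝ)..s, g r := by
    rw [← integral_indicator hS, integral_prod _ (hprod.indicator hS),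
      intervalIntegral.integral_of_le ht]
    refine setIntegral_congr_fun measurableSet_Ioc fun s hs => ?_
    have : ∀ y, Set.indicator {z : ℝ × ℝ | z.2 ≤ z.1} (fun z => f z.1 * g z.2) (s, y) =
        (Set.Iic s).indicator (fun y => f s * g y) y := fun y => rfl
    simp only [this]
    rw [integral_indicator measurableSet_Iic, hμ, Measure.restrict_restrict measurableSet_Iic,
      intervalIntegral.integral_of_le hs.1.le]
    have hset : Set.Iic s ∩ Set.Ioc 0 t = Set.Ioc 0 s := by
      ext y
      simp only [Set.mem_inter_iff, Set.mem_Iic, Set.mem_Ioc]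
      exact ⟨fun h => ⟨h.2.1, h.1⟩, fun h => ⟨h.2, h.1, h.2.trans hs.2⟩⟩
    rw [hset]
    exact integral_const_mul_of_integrable (hg.mono_set (Set.Ioc_subset_Ioc_right hs.2))
  have e2 : ∫ z in {z : ℝ × ℝ | z.2 ≤ z.1}ᶜ, f z.1 * g z.2 ∂(μ.prod μ) =
      ∫ s in (0 : ℝ)..t, (∫ r in (0 : ℝ)..s, f r) * g s := by
    rw [← integral_indicator hS.compl, integral_prod_symm _ (hprod.indicator hS.compl),
      intervalIntegral.integral_of_le ht]
    refine setIntegral_congr_fun measurableSet_Ioc fun s hs => ?_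
    have : ∀ x, Set.indicator {z : ℝ × ℝ | z.2 ≤ z.1}ᶜ (fun z => f z.1 * g z.2) (x, s) =
        (Set.Iio s).indicator (fun x => f x * g s) x := by
      intro x
      by_cases h : s ≤ x
      · rw [Set.indicator_of_notMem (by simpa using h), Set.indicator_of_notMem (by simpa using h)]
      · rw [Set.indicator_of_mem (by simpa using h), Set.indicator_of_mem (by simpa using h)]
    simp only [this]
    rw [integral_indicator measurableSet_Iio, hμ, Measure.restrict_restrict measurableSet_Iio,
      intervalIntegral.integral_of_le hs.1.le]
    have hset : Set.Iio s ∩ Set.Ioc 0 t = Set.Ioo 0 s := by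
      ext y
      simp only [Set.mem_inter_iff, Set.mem_Iio, Set.mem_Ioc, Set.mem_Ioo]
      exact ⟨fun h => ⟨h.2.1, h.1⟩, fun h => ⟨h.2, h.1, h.2.le.trans hs.2⟩⟩
    rw [hset, ← integral_Ioc_eq_integral_Ioo]
    exact integral_mul_const_of_integrable (hf.mono_set (Set.Ioc_subset_Ioc_right hs.2))
  rw [intervalIntegral.integral_of_le ht, intervalIntegral.integral_of_le ht, ← e1, ← e2, h1, e0]

/-- Integration by parts, i.e. the Rota-Baxter identity of weight zero for `primitive`. -/
theorem parts (f g : LocIntFun B) (t : ℝ) :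
    primitive f t * primitive g t = primitive (precFun f g + succFun f g) t := by
  rw [primitive_add]
  change (∫ s in (0 : ℝ)..t, f.1 s) * (∫ s in (0 : ℝ)..t, g.1 s) =
      (∫ s in (0 : ℝ)..t, f.1 s * ∫ r in (0 : ℝ)..s, g.1 r) +
        ∫ s in (0 : ℝ)..t, (∫ r in (0 : ℝ)..s, f.1 r) * g.1 s
  rcases le_total 0 t with ht | ht
  · exact parts_aux ht ((intervalIntegrable_iff_integrableOn_Ioc_of_le ht).1
      (f.intervalIntegrable 0 t)) ((intervalIntegrable_iff_integrableOn_Ioc_of_le ht).1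
      (g.intervalIntegrable 0 t))
  · have ht' : 0 ≤ -t := neg_nonneg.2 ht
    have key : ∀ (h : ℝ → B) (x : ℝ), ∫ s in (0 : ℝ)..x, h s = -∫ s in (0 : ℝ)..(-x), h (-s) := by
      intro h x
      rw [intervalIntegral.integral_comp_neg h, neg_neg, neg_zero, intervalIntegral.integral_symm]
    have hi : ∀ h : LocIntFun B, IntegrableOn (fun s => h.1 (-s)) (Set.Ioc 0 (-t)) volume := by
      intro h
      have := (IntervalIntegrable.iff_comp_neg (f := h.1) (a := 0) (b := t)).1
        (h.intervalIntegrable 0 t)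
      rw [neg_zero] at this
      exact (intervalIntegrable_iff_integrableOn_Ioc_of_le ht').1 this
    have := parts_aux ht' (hi f) (hi g)
    rw [key f.1 t, key g.1 t, neg_mul_neg, this, key _ t, key (fun s => _ * g.1 s) t]
    simp only [key g.1 (-_), key f.1 (-_), neg_neg, mul_neg, neg_mul,
      intervalIntegral.integral_neg]

/-- The dendriform structure on locally integrable functions given by the Riemann integral. -/
instance : DendriformAlgebra (LocIntFun B) where
  prec := precFun
  succ := succFun
  add_prec a b c := Subtype.ext <| funext fun t => add_mul (a.1 t) (b.1 t) _
  prec_add a b c := Subtype.ext <| funext fun t => by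
    change a.1 t * primitive (b + c) t = a.1 t * primitive b t + a.1 t * primitive c t
    rw [primitive_add, mul_add]
  smul_prec r a b := Subtype.ext <| funext fun t => smul_mul_assoc r (a.1 t) _
  prec_smul r a b := Subtype.ext <| funext fun t => by
    change a.1 t * primitive (r • b) t = r • (a.1 t * primitive b t)
    rw [primitive_smul, mul_smul_comm]
  add_succ a b c := Subtype.ext <| funext fun t => by
    change primitive (a + b) t * c.1 t = primitive a t * c.1 t + primitive b t * c.1 t
    rw [primitive_add, add_mul]
  succ_add a b c := Subtype.ext <| funext fun t => mul_add _ (b.1 t) (c.1 t)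
  smul_succ r a b := Subtype.ext <| funext fun t => by
    change primitive (r • a) t * b.1 t = r • (primitive a t * b.1 t)
    rw [primitive_smul, smul_mul_assoc]
  succ_smul r a b := Subtype.ext <| funext fun t => mul_smul_comm r _ (b.1 t)
  prec_prec a b c := Subtype.ext <| funext fun t => by
    change a.1 t * primitive b t * primitive c t =
      a.1 t * primitive (precFun b c + succFun b c) t
    rw [← parts, mul_assoc]
  succ_prec a b c := Subtype.ext <| funext fun t => mul_assoc _ (b.1 t) _
  succ_succ a b c := Subtype.ext <| funext fun t => by
    change primitive a t * (primitive b t * c.1 t) =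
      primitive (precFun a b + succFun a b) t * c.1 t
    rw [← parts, mul_assoc]

end LocIntFun

/-- The open simplex `{u | 0 < u_n < ⋯ < u_1 < s}`. -/
def simplexDelta (n : ℕ) (s : ℝ) : Set (Fin n → ℝ) :=
  {u | (∀ i, 0 < u i ∧ u i < s) ∧ StrictAnti u}

/-- The number `d(σ)` of descents: indices `i` with `i + 1` still an index and `σ i > σ (i + 1)`. -/
def descents {n : ℕ} (σ : Equiv.Perm (Fin n)) : ℕ :=
  Set.ncard {i : Fin n | ∃ h : (i : ℕ) + 1 < n, σ ⟨i + 1, h⟩ < σ i}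

section IteratedIntegrals

variable {B : Type*} [NormedRing B] [NormedAlgebra ℝ B]

/-- The ordered product `a(u_{σ(1)}) a(u_{σ(2)}) ⋯ a(u_{σ(n)})`. -/
def permProduct (a : ℝ → B) {n : ℕ} (σ : Equiv.Perm (Fin n)) (u : Fin n → ℝ) : B :=
  (List.ofFn fun i => a (u (σ i))).prod

/-- The iterated integral of `permProduct a σ` over the simplex. -/
def permIntegral (a : ℝ → B) {n : ℕ} (σ : Equiv.Perm (Fin n)) (s : ℝ) : B :=
  ∫ u in simplexDelta n s, permProduct a σ u

/-- The function `F̃_a(σ)`, the derivative in `s` of the iterated integral. -/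
def permFun (a : ℝ → B) {n : ℕ} (σ : Equiv.Perm (Fin n)) (s : ℝ) : B :=
  deriv (permIntegral a σ) s

end IteratedIntegrals

end

/-! For fixed t the map f ↦ `primitive f t` turns `star` into the product of B (integration by
parts). Hence the primitive of log^*(𝟏 + x) is, degree by degree, the ordinary logarithm of 1 + P,
where P is the power series of primitives of x. For the solution of the linear equation, the
coefficient of λ^n in P, n ≥ 1, is the integral of a(v_1)⋯a(v_n) over decreasing tuples in (0,s)^n
(`primitive_nestedPrec`).

The coefficient of λ^n in P^k is therefore an integral over the cube (0,s)^n, in which a(v_1)⋯a(v_n)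
is weighted by the number of ways to cut v into k decreasing blocks (`integral_blockCount`). At a
weak ascent the cut is forced, at a strict descent it is optional. With d weak ascents, the numbers
of cuttings have generating polynomial X^d (1+X)^(n-1-d), and the logarithm's coefficients turn it
into the Beta integral (-1)^d / (n * C(n-1,d)) (`sum_log_blockCount`).

Up to a null set the cube is the disjoint union of n! chambers. On the chamber of σ the tuple is u ∘
σ with u decreasing, so its weak ascents are the descents of σ. This proves the formula for
primitives at every s > 0 (`primitive_coeff_log`); Lebesgue differentiation then gives it almost
everywhere. -/

noncomputable section

/-! ### Combinatorics: cutting a list into decreasing blocks, and the resulting weights. -/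

section DecreasingBlocks

open Polynomial

open Classical in
/-- The indicator of the nonempty strictly decreasing lists. -/
def decreasingIndicator (l : List ℝ) : ℝ := if l ≠ [] ∧ l.IsChain (· > ·) then 1 else 0

/-- The number of ways to cut a list into `k` nonempty strictly decreasing blocks. -/
def blockCount : ℕ → List ℝ → ℝ
  | 0, l => if l = [] then 1 else 0
  | k + 1, l => ∑ m ∈ Finset.range (l.length + 1),
      decreasingIndicator (l.take m) * blockCount k (l.drop m)

/-- The number of consecutive pairs in a list at which the list fails to be strictly decreasing. -/
def weakAscents : List ℝ → ℕ
  | x :: y :: l => weakAscents (y :: l) + if y < x then 0 else 1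
  | _ => 0

theorem decreasingIndicator_nil : decreasingIndicator [] = 0 := by
  simp [decreasingIndicator]

theorem decreasingIndicator_singleton (x : ℝ) : decreasingIndicator [x] = 1 := by
  simp [decreasingIndicator]

theorem decreasingIndicator_cons_cons (x y : ℝ) (l : List ℝ) :
    decreasingIndicator (x :: y :: l) = if y < x then decreasingIndicator (y :: l) else 0 := by
  by_cases h : y < x <;> simp [decreasingIndicator, h]

theorem blockCount_zero_cons (x : ℝ) (l : List ℝ) : blockCount 0 (x :: l) = 0 := by
  simp [blockCount]

theorem blockCount_succ_cons (k : ℕ) (x : ℝ) (l : List ℝ) :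
    blockCount (k + 1) (x :: l) = ∑ m ∈ Finset.range (l.length + 1),
      decreasingIndicator (x :: l.take m) * blockCount k (l.drop m) := by
  rw [blockCount, List.length_cons, Finset.sum_range_succ']
  simp [decreasingIndicator_nil]

theorem blockCount_succ_singleton (k : ℕ) (x : ℝ) :
    blockCount (k + 1) [x] = if k = 0 then 1 else 0 := by
  rw [blockCount_succ_cons]
  cases k with
  | zero => simp [decreasingIndicator_singleton, blockCount]
  | succ k => simp [decreasingIndicator_nil, blockCount]

/-- Either `x` is a block by itself, or it joins the first block of `y :: l`, which requires `y <
x`. -/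
theorem blockCount_succ_cons_cons (k : ℕ) (x y : ℝ) (l : List ℝ) :
    blockCount (k + 1) (x :: y :: l) =
      blockCount k (y :: l) + if y < x then blockCount (k + 1) (y :: l) else 0 := by
  rw [blockCount_succ_cons, List.length_cons, Finset.sum_range_succ', blockCount_succ_cons]
  simp only [List.take_succ_cons, List.drop_succ_cons, decreasingIndicator_cons_cons,
    List.take_zero, List.drop_zero, decreasingIndicator_singleton, one_mul]
  split_ifs <;> simp [add_comm]

theorem weakAscents_cons_le (x : ℝ) (l : List ℝ) : weakAscents (x :: l) ≤ l.length := by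
  induction l generalizing x with
  | nil => simp [weakAscents]
  | cons y l ih =>
    have := ih y
    rw [weakAscents, List.length_cons]
    split_ifs <;> omega

/-- The gaps between neighbours are independent: a weak ascent forces a cut (factor `X`), a strict
descent allows one (factor `1 + X`). The exponent counts cuts, one fewer than blocks. -/
theorem blockCount_eq_coeff (k : ℕ) (x : ℝ) (l : List ℝ) :
    blockCount (k + 1) (x :: l) = (X ^ weakAscents (x :: l) *
      (1 + X) ^ (l.length - weakAscents (x :: l)) : ℝ[X]).coeff k := by
  induction l generalizing k x with
  | nil => simp [blockCount_succ_singleton, weakAscents, coeff_one]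
  | cons y l ih =>
    have hle := weakAscents_cons_le y l
    rw [blockCount_succ_cons_cons, weakAscents, List.length_cons]
    have hX : ∀ p : ℝ[X], (X * p).coeff k = if k = 0 then 0 else p.coeff (k - 1) := by
      intro p
      cases k <;> simp
    have h0 : blockCount k (y :: l) = (X * (X ^ weakAscents (y :: l) *
      (1 + X) ^ (l.length - weakAscents (y :: l))) : ℝ[X]).coeff k := by
      rw [hX]
      cases k with
      | zero => simp [blockCount_zero_cons]
      | succ k => simp [ih]
    rw [h0]
    split_ifs with h
    · rw [ih, ← coeff_add, add_zero, Nat.sub_add_comm hle, pow_succ (1 + X)]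
      congr 1
      ring
    · rw [add_zero, Nat.add_sub_add_right, pow_succ' X, mul_assoc]

/-- The functional X^k ↦ (-1)^k/(k+1) is p ↦ ∫_0^1 p(-x) dx, so the value is a Beta integral. The
induction on `m` replaces the integral by (1+X)^(m+1) = (1+X)^m + X(1+X)^m; the bound `h` keeps
every monomial inside the sum. -/
theorem sum_log_coeff (N m d : ℕ) (h : d + m < N) :
    ∑ k ∈ Finset.range N, ((-1 : ℝ) ^ k / ((k : ℝ) + 1)) *
      (X ^ d * (1 + X) ^ m : ℝ[X]).coeff k =
    (-1) ^ d * ((d.factorial * m.factorial : ℝ) / (d + m + 1).factorial) := by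
  induction m generalizing d with
  | zero =>
    rw [Finset.sum_eq_single_of_mem d (Finset.mem_range.2 (by omega))]
    · have := Nat.factorial_ne_zero d
      simp [Nat.factorial_succ]
      field_simp
    · intro b _ hb
      simp [coeff_X_pow, hb]
  | succ m ih =>
    have e : (X ^ d * (1 + X) ^ (m + 1) : ℝ[X]) =
      X ^ d * (1 + X) ^ m + X ^ (d + 1) * (1 + X) ^ m := by ring
    simp only [e, coeff_add, mul_add, Finset.sum_add_distrib]
    rw [ih d (by omega), ih (d + 1) (by omega), show d + 1 + m + 1 = (d + m + 1) + 1 by ring,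
      show d + (m + 1) + 1 = (d + m + 1) + 1 by ring, Nat.factorial_succ (d + m + 1),
      Nat.factorial_succ d, Nat.factorial_succ m, pow_succ]
    have := Nat.factorial_ne_zero (d + m + 1)
    push_cast
    field_simp
    ring

/-- The weight with which a list of length `n` enters the logarithm. -/
theorem sum_log_blockCount (n : ℕ) (hn : 0 < n) (l : List ℝ) (hl : l.length = n) :
    ∑ k ∈ Finset.range n, ((-1 : ℝ) ^ k / ((k : ℝ) + 1)) * blockCount (k + 1) l =
      (1 / (n : ℝ)) * ((-1 : ℝ) ^ weakAscents l / ((n - 1).choose (weakAscents l) : ℝ)) := by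
  obtain _ | ⟨x, l⟩ := l
  · simp at hl; omega
  subst hl
  have hle := weakAscents_cons_le x l
  simp only [blockCount_eq_coeff]
  -- The two exponents add up to `l.length`, one less than the length of `x :: l`, which produces
  -- the binomial coefficient.
  rw [sum_log_coeff _ _ _ (by simp; omega)]
  simp only [List.length_cons, Nat.add_sub_cancel]
  rw [Nat.cast_choose ℝ hle, Nat.add_sub_cancel' hle, Nat.factorial_succ]
  have h1 := Nat.factorial_ne_zero l.length
  have h2 := Nat.factorial_ne_zero (weakAscents (x :: l))
  have h3 := Nat.factorial_ne_zero (l.length - weakAscents (x :: l))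
  push_cast
  field_simp

open Classical in
theorem weakAscents_ofFn {n : ℕ} (v : Fin n → ℝ) :
    weakAscents (List.ofFn v) =
      ∑ i : Fin n, if ∃ h : (i : ℕ) + 1 < n, ¬ v ⟨i + 1, h⟩ < v i then 1 else 0 := by
  induction n with
  | zero => simp [weakAscents]
  | succ n ih =>
    rw [List.ofFn_succ, Fin.sum_univ_succ]
    cases n with
    | zero =>
      rw [if_neg fun ⟨h, _⟩ => by simp at h]
      rw [Finset.univ_eq_empty, Finset.sum_empty]
      rfl
    | succ n =>
      have := ih fun i => v i.succ
      rw [List.ofFn_succ] at this ⊢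
      rw [weakAscents, this, add_comm]
      congr 1
      · have : (∃ h : ((0 : Fin (n + 1 + 1)) : ℕ) + 1 < n + 1 + 1,
          ¬ v ⟨((0 : Fin (n + 1 + 1)) : ℕ) + 1, h⟩ < v 0) ↔ ¬ v (Fin.succ 0) < v 0 :=
          ⟨fun ⟨_, h⟩ => h, fun h => ⟨by simp, h⟩⟩
        rw [if_congr this rfl rfl]
        by_cases hlt : v (Fin.succ 0) < v 0
        · rw [if_pos hlt, if_neg (not_not.2 hlt)]
        · rw [if_neg hlt, if_pos hlt]
      · refine Finset.sum_congr rfl fun i _ => if_congr ?_ rfl rfl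
        exact ⟨fun ⟨h, h'⟩ => ⟨by simpa using h, h'⟩, fun ⟨h, h'⟩ => ⟨by simpa using h, h'⟩⟩

/-- A decreasing `u` reverses order, so weak ascents of `u ∘ σ` are the places where σ(i+1) ≤ σ(i);
equality is excluded by injectivity. -/
theorem weakAscents_ofFn_comp {n : ℕ} (σ : Equiv.Perm (Fin n)) {u : Fin n → ℝ}
    (hu : StrictAnti u) : weakAscents (List.ofFn fun i => u (σ i)) = descents σ := by
  classical
  rw [weakAscents_ofFn, descents, ← Finset.card_filter, ← Set.ncard_coe_finset]
  congr 1
  ext i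
  simp only [Finset.coe_filter, Finset.mem_univ, true_and, Set.mem_ofPred_eq, hu.lt_iff_gt, not_lt]
  refine exists_congr fun h => ⟨fun h' => lt_of_le_of_ne h' fun e => ?_, le_of_lt⟩
  have := congrArg Fin.val (σ.injective e)
  simp at this

end DecreasingBlocks

/-! ### The solution of the linear equation and its λ-adic logarithm. -/

section Logarithm

open DendriformAlgebra FormalSeries
open Finset.HasAntidiagonal (antidiagonal)

theorem FormalSeries.ext {D : Type*} {x y : FormalSeries D} (h : ∀ n, coeff n x = coeff n y) : x = y :=
  funext h

theorem FormalSeries.coeff_add {D : Type*} [AddCommGroup D] (x y : FormalSeries D) (n : ℕ) :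
    coeff n (x + y) = coeff n x + coeff n y := rfl

theorem FormalSeries.coeff_sub {D : Type*} [AddCommGroup D] (x y : FormalSeries D) (n : ℕ) :
    coeff n (x - y) = coeff n x - coeff n y := rfl

theorem FormalSeries.coeff_sum_smul {D : Type*} [AddCommGroup D] [Module ℝ D] (s : Finset ℕ)
    (c : ℕ → ℝ) (x : ℕ → FormalSeries D) (n : ℕ) :
    coeff n (∑ j ∈ s, c j • x j) = ∑ j ∈ s, c j • coeff n (x j) :=
  Finset.sum_apply n s fun j => c j • x j

variable {D : Type*} [AddCommGroup D] [Module ℝ D] [DendriformAlgebra D]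

theorem FormalSeries.coeff_star (x y : FormalSeries D) (n : ℕ) :
    coeff n (star x y) = ∑ p ∈ antidiagonal n, star (coeff p.1 x) (coeff p.2 y) :=
  (Finset.sum_add_distrib).symm

theorem DendriformAlgebra.zero_prec (x : D) : (0 : D) ≺ x = 0 := by
  simpa using smul_prec (0 : ℝ) (0 : D) x

theorem DendriformAlgebra.zero_succ (x : D) : (0 : D) ≻ x = 0 := by
  simpa using smul_succ (0 : ℝ) (0 : D) x

theorem DendriformAlgebra.prec_zero (x : D) : x ≺ (0 : D) = 0 := by
  simpa using prec_smul (0 : ℝ) x (0 : D)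

theorem DendriformAlgebra.succ_zero (x : D) : x ≻ (0 : D) = 0 := by
  simpa using succ_smul (0 : ℝ) x (0 : D)

theorem DendriformAlgebra.zero_star (x : D) : star 0 x = 0 := by
  rw [star, zero_prec, zero_succ, add_zero]

theorem DendriformAlgebra.star_zero (x : D) : star x 0 = 0 := by
  rw [star, prec_zero, succ_zero, add_zero]

theorem FormalSeries.coeff_lam_prec_zero (a : D) (x : FormalSeries D) :
    coeff 0 (lam a ≺ x) = 0 := by
  change ∑ p ∈ antidiagonal 0, lam a p.1 ≺ x p.2 = 0
  simp [lam, zero_prec]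

theorem FormalSeries.coeff_lam_prec_succ (a : D) (x : FormalSeries D) (n : ℕ) :
    coeff (n + 1) (lam a ≺ x) = a ≺ coeff n x := by
  change ∑ p ∈ antidiagonal (n + 1), lam a p.1 ≺ x p.2 = a ≺ x n
  rw [Finset.sum_eq_single_of_mem (1, n) (by simp [add_comm])]
  · simp [lam]
  · rintro ⟨i, j⟩ hij hne
    have hi : i ≠ 1 := by
      rintro rfl
      rw [Finset.HasAntidiagonal.mem_antidiagonal] at hij
      exact hne (Prod.ext rfl (by simp at hij ⊢; omega))
    simp [lam, hi, zero_prec]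

/-- The right-nested words `a ≺ (a ≺ (⋯ ≺ a))`, with `n + 1` letters. -/
def nestedPrec (a : D) : ℕ → D
  | 0 => a
  | n + 1 => a ≺ nestedPrec a n

/-- The series `∑ λ ^ (n + 1) • nestedPrec a n`. -/
def nestedSeries (a : D) : FormalSeries D
  | 0 => 0
  | n + 1 => nestedPrec a n

theorem nestedSeries_fixed (a : D) :
    nestedSeries a = lam a + lam a ≺ nestedSeries a := by
  refine FormalSeries.ext fun n => ?_
  rw [coeff_add]
  rcases n with _ | n
  · rw [coeff_lam_prec_zero, add_zero]
    rfl
  · rw [coeff_lam_prec_succ]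
    rcases n with _ | n
    · change a = a + a ≺ (0 : D)
      rw [prec_zero, add_zero]
    · change a ≺ nestedPrec a n = 0 + a ≺ nestedPrec a n
      rw [zero_add]

/-- The operation `lam a ≺ ·` raises degree by one, so the equation is a recursion on coefficients;
this gives existence and uniqueness together. -/
theorem solvesLinear_lam_iff (a : D) (X : Augmented (FormalSeries D)) :
    Augmented.SolvesLinear (lam a) X ↔ X = Augmented.onePlus (nestedSeries a) := by
  constructor
  · intro h
    have h1 : X.scalar = 1 := congrArg Augmented.scalar h
    have h2 : X.vec = X.scalar • lam a + lam a ≺ X.vec := congrArg Augmented.vec h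
    rw [h1, one_smul] at h2
    refine Augmented.ext h1 (FormalSeries.ext fun n => ?_)
    change coeff n X.vec = coeff n (nestedSeries a)
    induction n with
    | zero =>
      rw [h2, nestedSeries_fixed, coeff_add, coeff_add, coeff_lam_prec_zero, coeff_lam_prec_zero]
    | succ n ih =>
      rw [h2, nestedSeries_fixed, coeff_add, coeff_add, coeff_lam_prec_succ, coeff_lam_prec_succ,
        ih]
  · rintro rfl
    refine Augmented.ext rfl ?_
    change nestedSeries a = (1 : ℝ) • lam a + lam a ≺ nestedSeries a
    rw [one_smul]
    exact nestedSeries_fixed a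

/-- `starPow x j` is a (j+1)-st power, hence divisible by λ^(j+1). Thus only `j < n` contribute to
degree `n` of the logarithm. -/
theorem FormalSeries.coeff_starPow_of_le {x : FormalSeries D} (hx : coeff 0 x = 0) (j n : ℕ)
    (h : n ≤ j) : coeff n (starPow x j) = 0 := by
  induction j generalizing n with
  | zero =>
    rw [Nat.le_zero.1 h]
    exact hx
  | succ j ih =>
    rw [starPow, coeff_star]
    refine Finset.sum_eq_zero fun p hp => ?_
    rw [Finset.HasAntidiagonal.mem_antidiagonal] at hp
    rcases Nat.eq_zero_or_pos p.2 with h2 | h2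
    · rw [h2, hx, DendriformAlgebra.star_zero]
    · rw [ih p.1 (by omega), DendriformAlgebra.zero_star]

/-- The coefficientwise finite sums defining `log^*(𝟏 + x)`. -/
def logSeries (x : FormalSeries D) : FormalSeries D := fun n =>
  ∑ j ∈ Finset.range n, ((-1 : ℝ) ^ j / ((j : ℝ) + 1)) • coeff n (starPow x j)

theorem coeff_partial_log {x : FormalSeries D} (hx : coeff 0 x = 0) {m n : ℕ} (h : n ≤ m) :
    coeff n (∑ j ∈ Finset.range m, ((-1 : ℝ) ^ j / ((j : ℝ) + 1)) • starPow x j) =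
      coeff n (logSeries x) := by
  rw [coeff_sum_smul]
  refine (Finset.sum_subset (Finset.range_mono h) fun j _ hj => ?_).symm
  rw [coeff_starPow_of_le hx j n (by simpa using hj), smul_zero]

/-- Each coefficient of the partial sums is eventually constant, and the λ-adic filtration is
separated, so the limit exists and is unique. -/
theorem isLogStar_filtration_iff {X : Augmented (FormalSeries D)} (h1 : X.scalar = 1)
    (h0 : coeff 0 X.vec = 0) (L : FormalSeries D) :
    Augmented.IsLogStar filtration X L ↔ L = logSeries X.vec := by
  constructor
  · rintro ⟨-, -, h⟩
    refine FormalSeries.ext fun n => ?_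
    obtain ⟨M, hM⟩ := h (n + 1)
    have := hM (max M n) (le_max_left _ _) n n.lt_succ_self
    rw [coeff_sub, coeff_partial_log h0 (le_max_right _ _), sub_eq_zero] at this
    exact this.symm
  · rintro rfl
    refine ⟨h1, fun n hn => ?_, fun p => ⟨p, fun m hm n hn => ?_⟩⟩
    · rw [Nat.lt_one_iff.1 hn]
      exact h0
    · rw [coeff_sub, coeff_partial_log h0 (hn.le.trans hm), sub_self]

end Logarithm

/-! ### Passing from the dendriform algebra to power series over B by taking primitives. -/

section Primitive

open DendriformAlgebra LocIntFun
open Finset.HasAntidiagonal (antidiagonal)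

variable {B : Type*} [NormedRing B] [NormedAlgebra ℝ B]

theorem LocIntFun.primitive_star (f g : LocIntFun B) (t : ℝ) :
    primitive (star f g) t = primitive f t * primitive g t :=
  (parts f g t).symm

/-- `primitive` at a fixed time, as a linear map. -/
def LocIntFun.primitiveAt (t : ℝ) : LocIntFun B →ₗ[ℝ] B where
  toFun f := primitive f t
  map_add' f g := primitive_add f g t
  map_smul' r f := primitive_smul r f t

/-- The power series of the primitives at time `t` of the coefficients of `x`. -/
def primitiveSeries (t : ℝ) (x : FormalSeries (LocIntFun B)) : PowerSeries B :=
  PowerSeries.mk fun n => primitive (FormalSeries.coeff n x) t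

theorem primitiveSeries_star (t : ℝ) (x y : FormalSeries (LocIntFun B)) :
    primitiveSeries t (star x y) = primitiveSeries t x * primitiveSeries t y := by
  ext n
  rw [PowerSeries.coeff_mul]
  simp only [primitiveSeries, PowerSeries.coeff_mk, FormalSeries.coeff_star, ← primitive_star]
  exact map_sum (primitiveAt t) _ _

theorem primitiveSeries_starPow (t : ℝ) (x : FormalSeries (LocIntFun B)) (j : ℕ) :
    primitiveSeries t (starPow x j) = primitiveSeries t x ^ (j + 1) := by
  induction j with
  | zero => rw [zero_add, pow_one, starPow]
  | succ j ih => rw [starPow, primitiveSeries_star, ih, ← pow_succ]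

/-- Taking primitives is linear and multiplicative for `star`, so it carries the dendriform
logarithm to the ordinary one. -/
theorem primitive_coeff_logSeries (t : ℝ) (x : FormalSeries (LocIntFun B)) (n : ℕ) :
    primitive (FormalSeries.coeff n (logSeries x)) t =
      ∑ j ∈ Finset.range n, ((-1 : ℝ) ^ j / ((j : ℝ) + 1)) •
        PowerSeries.coeff n (primitiveSeries t x ^ (j + 1)) := by
  have : primitive (FormalSeries.coeff n (logSeries x)) t =
      ∑ j ∈ Finset.range n, ((-1 : ℝ) ^ j / ((j : ℝ) + 1)) •
        primitive (FormalSeries.coeff n (starPow x j)) t := by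
    change primitiveAt t (∑ j ∈ Finset.range n, ((-1 : ℝ) ^ j / ((j : ℝ) + 1)) •
      FormalSeries.coeff n (starPow x j)) = _
    rw [map_sum]
    simp only [map_smul]
    rfl
  rw [this]
  refine Finset.sum_congr rfl fun j _ => ?_
  rw [← primitiveSeries_starPow, primitiveSeries, PowerSeries.coeff_mk]

end Primitive

/-! ### Measure theory of cubes, simplices and permutation chambers. -/

section Simplices

/-- The open cube `(0, s) ^ n`. -/
def openCube (n : ℕ) (s : ℝ) : Set (Fin n → ℝ) := Set.univ.pi fun _ => Set.Ioo 0 s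

theorem mem_openCube {n : ℕ} {s : ℝ} {v : Fin n → ℝ} :
    v ∈ openCube n s ↔ ∀ i, 0 < v i ∧ v i < s := by
  simp [openCube, Set.mem_pi]

theorem measurableSet_openCube (n : ℕ) (s : ℝ) : MeasurableSet (openCube n s) :=
  MeasurableSet.univ_pi fun _ => measurableSet_Ioo

theorem simplexDelta_eq_inter (n : ℕ) (s : ℝ) :
    simplexDelta n s = openCube n s ∩ {u | StrictAnti u} := by
  ext u
  rw [Set.mem_inter_iff, mem_openCube]
  rfl

theorem measurableSet_strictAnti (n : ℕ) : MeasurableSet {u : Fin n → ℝ | StrictAnti u} := by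
  have : {u : Fin n → ℝ | StrictAnti u} = ⋂ i, ⋂ j, ⋂ _ : i < j, {u | u j < u i} := by
    ext u
    simp only [Set.mem_iInter]
    exact ⟨fun h i j hij => h hij, fun h i j hij => h i j hij⟩
  rw [this]
  exact MeasurableSet.iInter fun i => MeasurableSet.iInter fun j => MeasurableSet.iInter fun _ =>
    measurableSet_lt (measurable_pi_apply j) (measurable_pi_apply i)

theorem measurableSet_simplexDelta (n : ℕ) (s : ℝ) : MeasurableSet (simplexDelta n s) := by
  rw [simplexDelta_eq_inter]
  exact (measurableSet_openCube n s).inter (measurableSet_strictAnti n)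

/-- The first coordinate is the largest, so it becomes the upper bound for the remaining ones. -/
theorem cons_mem_simplexDelta {n : ℕ} {s t : ℝ} {v : Fin n → ℝ} :
    (Fin.cons t v : Fin (n + 1) → ℝ) ∈ simplexDelta (n + 1) s ↔
      t ∈ Set.Ioo 0 s ∧ v ∈ simplexDelta n t := by
  constructor
  · rintro ⟨h1, h2⟩
    refine ⟨by simpa using h1 0, fun i => ⟨by simpa using (h1 i.succ).1, ?_⟩, fun i j hij => ?_⟩
    · simpa using h2 (Fin.succ_pos i)
    · simpa using h2 (Fin.succ_lt_succ_iff.2 hij)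
  · rintro ⟨h1, h2, h3⟩
    constructor
    · refine Fin.cases (by simpa using h1) fun i => ?_
      simpa using ⟨(h2 i).1, (h2 i).2.trans h1.2⟩
    · intro i j
      refine Fin.cases (fun h => absurd h (Fin.not_lt_zero i)) (fun j => ?_) j
      refine Fin.cases (fun _ => by simpa using (h2 j).2) (fun i hij => ?_) i
      simpa using h3 (Fin.succ_lt_succ_iff.1 hij)

/-- Concatenation of tuples, as a measurable equivalence. -/
def appendMeasurableEquiv (m p : ℕ) : (Fin m → ℝ) × (Fin p → ℝ) ≃ᵐ (Fin (m + p) → ℝ) :=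
  (MeasurableEquiv.sumPiEquivProdPi fun _ : Fin m ⊕ Fin p => ℝ).symm.trans
    (MeasurableEquiv.piCongrLeft (fun _ => ℝ) finSumFinEquiv)

theorem appendMeasurableEquiv_apply {m p : ℕ} (v : Fin m → ℝ) (w : Fin p → ℝ) :
    appendMeasurableEquiv m p (v, w) = Fin.append v w := by
  funext i
  have key : ∀ j : Fin m ⊕ Fin p,
      appendMeasurableEquiv m p (v, w) (finSumFinEquiv j) = Sum.elim v w j := by
    intro j
    rw [appendMeasurableEquiv, MeasurableEquiv.trans_apply,
      MeasurableEquiv.piCongrLeft_apply_apply]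
    cases j <;> rfl
  refine Fin.addCases (fun i => ?_) (fun i => ?_) i
  · rw [Fin.append_left]
    exact key (Sum.inl i)
  · rw [Fin.append_right]
    exact key (Sum.inr i)

theorem measurePreserving_appendMeasurableEquiv (m p : ℕ) :
    MeasurePreserving (appendMeasurableEquiv m p) volume volume :=
  (volume_measurePreserving_sumPiEquivProdPi_symm _).trans
    (volume_measurePreserving_piCongrLeft _ _)

theorem append_mem_openCube {m p : ℕ} {s : ℝ} {v : Fin m → ℝ} {w : Fin p → ℝ} :
    Fin.append v w ∈ openCube (m + p) s ↔ v ∈ openCube m s ∧ w ∈ openCube p s := by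
  simp only [mem_openCube]
  constructor
  · exact fun h => ⟨fun i => by simpa using h (Fin.castAdd p i),
      fun i => by simpa using h (Fin.natAdd m i)⟩
  · exact fun h => Fin.addCases (fun i => by simpa using h.1 i) (fun i => by simpa using h.2 i)

/-- Fubini for a product of functions of separate variables, with the factors kept in order because
B need not commute. -/
theorem integral_append {B : Type*} [NormedRing B] [NormedAlgebra ℝ B] [CompleteSpace B]
    {m p : ℕ} {s : ℝ} {f : (Fin m → ℝ) → B} {g : (Fin p → ℝ) → B} {F : (Fin (m + p) → ℝ) → B}
    (hF : ∀ v w, F (Fin.append v w) = f v * g w) (hf : IntegrableOn f (openCube m s))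
    (hg : IntegrableOn g (openCube p s)) :
    IntegrableOn F (openCube (m + p) s) ∧
      ∫ u in openCube (m + p) s, F u =
        (∫ v in openCube m s, f v) * ∫ w in openCube p s, g w := by
  have hmp := measurePreserving_appendMeasurableEquiv m p
  have hemb := (appendMeasurableEquiv m p).measurableEmbedding
  have hpre : appendMeasurableEquiv m p ⁻¹' openCube (m + p) s = openCube m s ×ˢ openCube p s := by
    ext ⟨v, w⟩
    rw [Set.mem_preimage, appendMeasurableEquiv_apply, append_mem_openCube]
    rfl
  have hcomp : ∀ z, F (appendMeasurableEquiv m p z) = f z.1 * g z.2 := by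
    rintro ⟨v, w⟩
    rw [appendMeasurableEquiv_apply, hF]
  have hvol : (volume : Measure ((Fin m → ℝ) × (Fin p → ℝ))).restrict
      (openCube m s ×ˢ openCube p s) =
      (volume.restrict (openCube m s)).prod (volume.restrict (openCube p s)) :=
    (Measure.prod_restrict _ _).symm
  have hint := Integrable.mul_prod hf hg
  constructor
  · rw [← hmp.integrableOn_comp_preimage hemb, hpre, IntegrableOn, hvol]
    exact hint.congr (Filter.Eventually.of_forall fun z => (hcomp z).symm)
  · rw [← hmp.setIntegral_preimage_emb hemb, hpre, hvol]
    simp only [hcomp]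
    rw [integral_prod _ hint]
    have : ∀ v, ∫ w, f v * g w ∂(volume.restrict (openCube p s)) =
        f v * ∫ w in openCube p s, g w := fun v => integral_const_mul_of_integrable hg
    simp only [this]
    exact integral_mul_const_of_integrable hf

/-- Fubini on the simplex, with the largest variable outside. -/
theorem integral_simplexDelta_succ {B : Type*} [NormedAddCommGroup B] [NormedSpace ℝ B]
    {n : ℕ} {s : ℝ} {F : (Fin (n + 1) → ℝ) → B}
    (hF : IntegrableOn F (simplexDelta (n + 1) s)) :
    IntegrableOn (fun t => ∫ v in simplexDelta n t, F (Fin.cons t v)) (Set.Ioo 0 s) ∧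
      ∫ u in simplexDelta (n + 1) s, F u =
        ∫ t in Set.Ioo 0 s, ∫ v in simplexDelta n t, F (Fin.cons t v) := by
  have hmp := (volume_preserving_piFinSuccAbove (fun _ : Fin (n + 1) => ℝ) 0).symm
  set e := (MeasurableEquiv.piFinSuccAbove (fun _ : Fin (n + 1) => ℝ) 0).symm with he
  have heq : ∀ t v, e (t, v) = Fin.cons t v := by
    intro t v
    rw [he, MeasurableEquiv.piFinSuccAbove_symm_apply]
    exact Fin.insertNth_zero' t v
  have hemb := e.measurableEmbedding
  have hS : MeasurableSet (e ⁻¹' simplexDelta (n + 1) s) :=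
    e.measurable (measurableSet_simplexDelta _ _)
  rw [← hmp.integrableOn_comp_preimage hemb, ← integrable_indicator_iff hS] at hF
  rw [← hmp.setIntegral_preimage_emb hemb, ← integral_indicator hS]
  -- The slice over `t` is the simplex of size `t` when `0 < t < s`, and is empty otherwise.
  have hind : ∀ t, (∫ v, (e ⁻¹' simplexDelta (n + 1) s).indicator (F ∘ e) (t, v)) =
      (Set.Ioo 0 s).indicator (fun t => ∫ v in simplexDelta n t, F (Fin.cons t v)) t := by
    intro t
    by_cases ht : t ∈ Set.Ioo 0 s
    · rw [Set.indicator_of_mem ht, ← integral_indicator (measurableSet_simplexDelta n t)]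
      congr 1
      funext v
      by_cases hv : v ∈ simplexDelta n t
      · rw [Set.indicator_of_mem hv, Set.indicator_of_mem, Function.comp_apply, heq]
        rw [Set.mem_preimage, heq]
        exact cons_mem_simplexDelta.2 ⟨ht, hv⟩
      · rw [Set.indicator_of_notMem hv, Set.indicator_of_notMem]
        rw [Set.mem_preimage, heq]
        exact fun h => hv (cons_mem_simplexDelta.1 h).2
    · rw [Set.indicator_of_notMem ht]
      refine integral_eq_zero_of_ae (Filter.Eventually.of_forall fun v => ?_)
      refine Set.indicator_of_notMem ?_ _
      rw [Set.mem_preimage, heq]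
      exact fun h => ht (cons_mem_simplexDelta.1 h).1
  constructor
  · rw [← integrable_indicator_iff measurableSet_Ioo]
    exact (Integrable.integral_prod_left hF).congr (Filter.Eventually.of_forall hind)
  · rw [← integral_indicator measurableSet_Ioo]
    refine (integral_prod _ hF).trans ?_
    simp only [hind]

/-- Permutation of the coordinates, `u ↦ u ∘ σ`. -/
def permMeasurableEquiv {n : ℕ} (σ : Equiv.Perm (Fin n)) : (Fin n → ℝ) ≃ᵐ (Fin n → ℝ) :=
  MeasurableEquiv.piCongrLeft (fun _ => ℝ) σ.symm

theorem permMeasurableEquiv_apply {n : ℕ} (σ : Equiv.Perm (Fin n)) (u : Fin n → ℝ) :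
    permMeasurableEquiv σ u = fun i => u (σ i) := by
  funext i
  have := MeasurableEquiv.piCongrLeft_apply_apply (β := fun _ => ℝ) σ.symm u (σ i)
  rwa [Equiv.symm_apply_apply] at this

theorem measurePreserving_permMeasurableEquiv {n : ℕ} (σ : Equiv.Perm (Fin n)) :
    MeasurePreserving (permMeasurableEquiv σ) volume volume :=
  volume_measurePreserving_piCongrLeft _ _

/-- The part of the open cube on which the coordinates are sorted by `σ`. -/
def permChamber {n : ℕ} (σ : Equiv.Perm (Fin n)) (s : ℝ) : Set (Fin n → ℝ) :=
  {v | (fun i => v (σ.symm i)) ∈ simplexDelta n s}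

theorem measurableSet_permChamber {n : ℕ} (σ : Equiv.Perm (Fin n)) (s : ℝ) :
    MeasurableSet (permChamber σ s) :=
  (measurable_pi_lambda _ fun i => measurable_pi_apply (σ.symm i))
    (measurableSet_simplexDelta n s)

theorem permChamber_subset_openCube {n : ℕ} (σ : Equiv.Perm (Fin n)) (s : ℝ) :
    permChamber σ s ⊆ openCube n s := fun v hv => mem_openCube.2 fun i => by
  simpa using hv.1 (σ i)

theorem permMeasurableEquiv_preimage {n : ℕ} (σ : Equiv.Perm (Fin n)) (s : ℝ) :
    permMeasurableEquiv σ ⁻¹' permChamber σ s = simplexDelta n s := by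
  ext u
  rw [Set.mem_preimage, permMeasurableEquiv_apply]
  simp [permChamber]

/-- The sorted rearrangement of a tuple is unique, and a tuple in a chamber has distinct entries, so
the sorting permutation is unique too. -/
theorem pairwise_disjoint_permChamber (n : ℕ) (s : ℝ) :
    Pairwise (Function.onFun Disjoint fun σ : Equiv.Perm (Fin n) => permChamber σ s) := by
  intro σ τ hne
  refine Set.disjoint_left.2 fun v hσ hτ => hne ?_
  have h := Tuple.unique_antitone (f := v) (σ := σ.symm) (τ := τ.symm)
    hσ.2.antitone hτ.2.antitone
  have hinj : Function.Injective v := by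
    intro i j hij
    have := hσ.2.injective (a₁ := σ i) (a₂ := σ j) (by simpa using hij)
    exact σ.injective this
  have : σ.symm = τ.symm := Equiv.ext fun i => hinj (congrFun h i)
  exact Equiv.symm_bijective.injective this

/-- Tuples with a repeated entry lie in finitely many hyperplanes `v i = v j`, each a proper
subspace. -/
theorem volume_not_injective (n : ℕ) :
    volume {v : Fin n → ℝ | ¬ Function.Injective v} = 0 := by
  have hsub : {v : Fin n → ℝ | ¬ Function.Injective v} ⊆
      ⋃ i, ⋃ j, ⋃ _ : i ≠ j, {v | v i = v j} := by
    intro v hv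
    obtain ⟨i, j, h, hne⟩ := Function.not_injective_iff.1 hv
    simp only [Set.mem_iUnion]
    exact ⟨i, j, hne, h⟩
  refine measure_mono_null hsub ?_
  refine measure_iUnion_null fun i => measure_iUnion_null fun j => measure_iUnion_null fun hij => ?_
  let K : Submodule ℝ (Fin n → ℝ) := LinearMap.ker
    ((LinearMap.proj i : (Fin n → ℝ) →ₗ[ℝ] ℝ) - LinearMap.proj j)
  have hK : {v : Fin n → ℝ | v i = v j} = K := by
    ext v
    exact sub_eq_zero.symm
  rw [hK]
  refine Measure.addHaar_submodule _ _ fun htop => ?_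
  -- The i-th basis vector violates `v i = v j`, so the subspace is proper.
  have : (Pi.single i (1 : ℝ) : Fin n → ℝ) ∈ K := htop ▸ Submodule.mem_top
  rw [← SetLike.mem_coe, ← hK] at this
  have h1 : (Pi.single i (1 : ℝ) : Fin n → ℝ) i = (Pi.single i (1 : ℝ) : Fin n → ℝ) j := this
  simp [hij.symm] at h1

theorem openCube_ae_eq_iUnion (n : ℕ) (s : ℝ) :
    (openCube n s : Set (Fin n → ℝ)) =ᵐ[volume] ⋃ σ : Equiv.Perm (Fin n), permChamber σ s := by
  have hinj : ∀ᵐ v : Fin n → ℝ, Function.Injective v := volume_not_injective n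
  filter_upwards [hinj] with v hv
  refine propext ⟨fun h => Set.mem_iUnion.2 ?_, fun h => ?_⟩
  -- Sorting `-v` increasingly sorts `v` decreasingly; the chamber is that of the inverse because
  -- `permChamber` is defined through `σ.symm`.
  · let τ : Equiv.Perm (Fin n) := Tuple.sort fun i => -v i
    have hmono : Monotone fun i => -v (τ i) := Tuple.monotone_sort fun i => -v i
    refine ⟨τ.symm, fun i => mem_openCube.1 h _, ?_⟩
    refine Antitone.strictAnti_of_injective (fun i j hij => neg_le_neg_iff.1 (hmono hij)) ?_
    exact hv.comp (Equiv.injective _)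
  · obtain ⟨σ, hσ⟩ := Set.mem_iUnion.1 h
    exact permChamber_subset_openCube σ s hσ

theorem integrableOn_comp_perm {B : Type*} [NormedAddCommGroup B]
    {n : ℕ} {s : ℝ} {F : (Fin n → ℝ) → B} (hF : IntegrableOn F (openCube n s))
    (σ : Equiv.Perm (Fin n)) :
    IntegrableOn (fun u => F fun i => u (σ i)) (simplexDelta n s) := by
  have h := hF.mono_set (permChamber_subset_openCube σ s)
  rw [← (measurePreserving_permMeasurableEquiv σ).integrableOn_comp_preimage
    (permMeasurableEquiv σ).measurableEmbedding, permMeasurableEquiv_preimage] at h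
  refine h.congr_fun (fun u _ => ?_) (measurableSet_simplexDelta n s)
  rw [Function.comp_apply, permMeasurableEquiv_apply]

/-- The chambers fill the cube up to a null set, and each is the image of the simplex under a
volume-preserving permutation of coordinates. -/
theorem integral_openCube_eq_sum {B : Type*} [NormedAddCommGroup B] [NormedSpace ℝ B]
    {n : ℕ} {s : ℝ} {F : (Fin n → ℝ) → B} (hF : IntegrableOn F (openCube n s)) :
    ∫ v in openCube n s, F v =
      ∑ σ : Equiv.Perm (Fin n), ∫ u in simplexDelta n s, F fun i => u (σ i) := by
  rw [setIntegral_congr_set (openCube_ae_eq_iUnion n s),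
    integral_iUnion_fintype (fun σ => measurableSet_permChamber σ s)
      (pairwise_disjoint_permChamber n s)
      fun σ => hF.mono_set (permChamber_subset_openCube σ s)]
  refine Finset.sum_congr rfl fun σ _ => ?_
  rw [← (measurePreserving_permMeasurableEquiv σ).setIntegral_preimage_emb
    (permMeasurableEquiv σ).measurableEmbedding, permMeasurableEquiv_preimage]
  simp only [permMeasurableEquiv_apply]

end Simplices

/-! ### Powers of the primitive series as weighted integrals over the cube. -/

section IteratedIntegralsOfLocIntFun

open DendriformAlgebra LocIntFun
open Finset.HasAntidiagonal (antidiagonal)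

variable {B : Type*} [NormedRing B]

/-- The product of the values of `a` along a list of times. -/
def listProduct (a : ℝ → B) (l : List ℝ) : B := (l.map a).prod

theorem listProduct_append (a : ℝ → B) (l l' : List ℝ) :
    listProduct a (l ++ l') = listProduct a l * listProduct a l' := by
  rw [listProduct, List.map_append, List.prod_append]
  rfl

theorem permProduct_eq_listProduct (a : ℝ → B) {n : ℕ} (σ : Equiv.Perm (Fin n)) (u : Fin n → ℝ) :
    permProduct a σ u = listProduct a (List.ofFn fun i => u (σ i)) := by
  rw [permProduct, listProduct, List.map_ofFn]
  rfl

theorem permProduct_one_cons (a : ℝ → B) {n : ℕ} (t : ℝ) (v : Fin n → ℝ) :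
    permProduct a (1 : Equiv.Perm (Fin (n + 1))) (Fin.cons t v) =
      a t * permProduct a (1 : Equiv.Perm (Fin n)) v := by
  rw [permProduct, List.ofFn_succ, List.prod_cons]
  rfl

theorem simplexDelta_zero (s : ℝ) : simplexDelta 0 s = Set.univ :=
  Set.eq_univ_of_forall fun _ => ⟨fun i => i.elim0, fun i => i.elim0⟩

theorem openCube_zero (s : ℝ) : openCube 0 s = Set.univ :=
  Set.eq_univ_of_forall fun _ => mem_openCube.2 fun i => i.elim0

theorem integrable_fin_zero (f : (Fin 0 → ℝ) → B) : Integrable f := by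
  have : f = fun _ => f Fin.elim0 := funext fun v => congrArg f (Subsingleton.elim _ _)
  rw [this, volume_pi, Measure.pi_of_empty _ Fin.elim0]
  exact integrable_const _

variable [NormedAlgebra ℝ B] [CompleteSpace B]

theorem integral_fin_zero (f : (Fin 0 → ℝ) → B) : ∫ v, f v = f Fin.elim0 := by
  rw [volume_pi, Measure.pi_of_empty _ Fin.elim0, integral_dirac]

/-- One letter at a time: `integral_append` with a single further variable preserves integrability.
-/
theorem integrableOn_listProduct (a : LocIntFun B) (n : ℕ) (s : ℝ) :
    IntegrableOn (fun v : Fin n → ℝ => listProduct a.1 (List.ofFn v)) (openCube n s) := by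
  induction n with
  | zero => exact (integrable_fin_zero _).integrableOn
  | succ n ih =>
    have h1 : IntegrableOn (fun w : Fin 1 → ℝ => a.1 (w 0)) (openCube 1 s) := by
      have ha : IntegrableOn a.1 (Set.Ioo 0 s) :=
        (a.2.integrableOn_isCompact isCompact_Icc).mono_set Set.Ioo_subset_Icc_self
      rw [← (volume_preserving_funUnique (Fin 1) ℝ).integrableOn_comp_preimage
        (MeasurableEquiv.funUnique (Fin 1) ℝ).measurableEmbedding] at ha
      refine ha.mono_set fun w hw => ?_
      exact mem_openCube.1 hw 0
    refine (integral_append (fun v w => ?_) ih h1).1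
    rw [List.ofFn_fin_append, listProduct_append]
    simp [listProduct]

theorem integrableOn_permProduct (a : LocIntFun B) {n : ℕ} (σ : Equiv.Perm (Fin n)) (s : ℝ) :
    IntegrableOn (permProduct a.1 σ) (simplexDelta n s) := by
  refine (integrableOn_comp_perm (integrableOn_listProduct a n s) σ).congr_fun (fun u _ => ?_)
    (measurableSet_simplexDelta n s)
  exact (permProduct_eq_listProduct a.1 σ u).symm

theorem permIntegral_fin_zero (a : ℝ → B) (s : ℝ) :
    permIntegral a (1 : Equiv.Perm (Fin 0)) s = 1 := by
  rw [permIntegral, simplexDelta_zero, Measure.restrict_univ, integral_fin_zero]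
  simp [permProduct]

/-- The largest variable carries the leftmost factor, so Fubini reproduces the recursion that
defines `nestedPrec`. -/
theorem permIntegral_one_succ (a : LocIntFun B) (n : ℕ) {s : ℝ} (hs : 0 < s) :
    permIntegral a.1 (1 : Equiv.Perm (Fin (n + 1))) s =
      ∫ t in (0 : ℝ)..s, a.1 t * permIntegral a.1 (1 : Equiv.Perm (Fin n)) t := by
  rw [permIntegral, (integral_simplexDelta_succ (integrableOn_permProduct a 1 s)).2,
    intervalIntegral.integral_of_le hs.le, integral_Ioc_eq_integral_Ioo]
  refine setIntegral_congr_fun measurableSet_Ioo fun t _ => ?_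
  simp only [permProduct_one_cons]
  exact integral_const_mul_of_integrable (integrableOn_permProduct a 1 t)

theorem primitive_nestedPrec (a : LocIntFun B) (n : ℕ) {s : ℝ} (hs : 0 < s) :
    primitive (nestedPrec a n) s = permIntegral a.1 (1 : Equiv.Perm (Fin (n + 1))) s := by
  induction n generalizing s with
  | zero =>
    rw [permIntegral_one_succ a 0 hs]
    simp only [permIntegral_fin_zero, mul_one]
    rfl
  | succ n ih =>
    rw [permIntegral_one_succ a (n + 1) hs]
    refine intervalIntegral.integral_congr_ae (Filter.Eventually.of_forall fun t ht => ?_)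
    rw [Set.uIoc_of_le hs.le] at ht
    rw [← ih ht.1]
    rfl

open Classical in
theorem decreasingIndicator_ofFn_succ {n : ℕ} (v : Fin (n + 1) → ℝ) :
    decreasingIndicator (List.ofFn v) = if StrictAnti v then 1 else 0 := by
  rw [decreasingIndicator]
  refine if_congr ?_ rfl rfl
  rw [List.isChain_iff_pairwise, List.pairwise_ofFn]
  exact ⟨fun h i j hij => h.2 hij, fun h => ⟨by simp, fun i j hij => h hij⟩⟩

theorem integral_decreasingIndicator (a : LocIntFun B) (n : ℕ) (s : ℝ) :
    IntegrableOn (fun v : Fin (n + 1) → ℝ =>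
      decreasingIndicator (List.ofFn v) • listProduct a.1 (List.ofFn v)) (openCube (n + 1) s) ∧
    ∫ v in openCube (n + 1) s, decreasingIndicator (List.ofFn v) • listProduct a.1 (List.ofFn v) =
      permIntegral a.1 (1 : Equiv.Perm (Fin (n + 1))) s := by
  classical
  have h : (fun v : Fin (n + 1) → ℝ =>
      decreasingIndicator (List.ofFn v) • listProduct a.1 (List.ofFn v)) =
      {u | StrictAnti u}.indicator (permProduct a.1 1) := by
    funext v
    rw [decreasingIndicator_ofFn_succ]
    by_cases hv : StrictAnti v
    · rw [if_pos hv, one_smul, Set.indicator_of_mem (show v ∈ {u | StrictAnti u} from hv),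
        permProduct_eq_listProduct]
      rfl
    · rw [if_neg hv, zero_smul, Set.indicator_of_notMem (show v ∉ {u | StrictAnti u} from hv)]
  rw [h]
  constructor
  · refine IntegrableOn.indicator ?_ (measurableSet_strictAnti _)
    refine (integrableOn_listProduct a (n + 1) s).congr_fun (fun u _ => ?_)
      (measurableSet_openCube _ s)
    exact (permProduct_eq_listProduct a.1 1 u).symm
  · rw [setIntegral_indicator (measurableSet_strictAnti _), ← simplexDelta_eq_inter, permIntegral]

theorem integral_decreasingIndicator_eq_coeff (a : LocIntFun B) (n : ℕ) {s : ℝ} (hs : 0 < s) :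
    IntegrableOn (fun v : Fin n → ℝ =>
      decreasingIndicator (List.ofFn v) • listProduct a.1 (List.ofFn v)) (openCube n s) ∧
    ∫ v in openCube n s, decreasingIndicator (List.ofFn v) • listProduct a.1 (List.ofFn v) =
      PowerSeries.coeff n (primitiveSeries s (nestedSeries a)) := by
  rw [primitiveSeries, PowerSeries.coeff_mk]
  cases n with
  | zero =>
    refine ⟨(integrable_fin_zero _).integrableOn, ?_⟩
    -- The empty block is not counted, in agreement with the vanishing constant coefficient.
    have : primitive (FormalSeries.coeff 0 (nestedSeries a)) s = 0 :=
      map_zero (primitiveAt s)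
    rw [this]
    simp [decreasingIndicator_nil]
  | succ n =>
    have := primitive_nestedPrec a n hs
    rw [← integral_decreasingIndicator a n s |>.2] at this
    exact ⟨(integral_decreasingIndicator a n s).1, this.symm⟩

/-- Splitting off the first block matches the Cauchy product P * P^k: for each length of that block
the integrand factors, and `integral_append` applies. -/
theorem integral_blockCount (a : LocIntFun B) (k n : ℕ) {s : ℝ} (hs : 0 < s) :
    IntegrableOn (fun v : Fin n → ℝ =>
      blockCount k (List.ofFn v) • listProduct a.1 (List.ofFn v)) (openCube n s) ∧
    ∫ v in openCube n s, blockCount k (List.ofFn v) • listProduct a.1 (List.ofFn v) =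
      PowerSeries.coeff n (primitiveSeries s (nestedSeries a) ^ k) := by
  induction k generalizing n with
  | zero =>
    rw [pow_zero, PowerSeries.coeff_one]
    cases n with
    | zero =>
      refine ⟨(integrable_fin_zero _).integrableOn, ?_⟩
      rw [openCube_zero, Measure.restrict_univ, integral_fin_zero]
      simp [blockCount, listProduct]
    | succ n => simp [List.ofFn_succ, blockCount_zero_cons]
  | succ k ih =>
    have key : ∀ p ∈ antidiagonal n, IntegrableOn (fun v : Fin n → ℝ =>
          (decreasingIndicator ((List.ofFn v).take p.1) * blockCount k ((List.ofFn v).drop p.1)) •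
            listProduct a.1 (List.ofFn v)) (openCube n s) ∧
        ∫ v in openCube n s,
          (decreasingIndicator ((List.ofFn v).take p.1) * blockCount k ((List.ofFn v).drop p.1)) •
            listProduct a.1 (List.ofFn v) =
        PowerSeries.coeff p.1 (primitiveSeries s (nestedSeries a)) *
          PowerSeries.coeff p.2 (primitiveSeries s (nestedSeries a) ^ k) := by
      rintro ⟨m, p⟩ hp
      rw [Finset.HasAntidiagonal.mem_antidiagonal] at hp
      subst hp
      rw [← (integral_decreasingIndicator_eq_coeff a m hs).2, ← (ih p).2]
      refine integral_append (fun v w => ?_) (integral_decreasingIndicator_eq_coeff a m hs).1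
        (ih p).1
      rw [List.ofFn_fin_append, List.take_left' List.length_ofFn,
        List.drop_left' List.length_ofFn, listProduct_append, smul_mul_smul_comm]
    have hsum : (fun v : Fin n → ℝ =>
        blockCount (k + 1) (List.ofFn v) • listProduct a.1 (List.ofFn v)) = fun v =>
        ∑ p ∈ antidiagonal n,
          (decreasingIndicator ((List.ofFn v).take p.1) * blockCount k ((List.ofFn v).drop p.1)) •
            listProduct a.1 (List.ofFn v) := by
      funext v
      rw [← Finset.sum_smul, Finset.Nat.sum_antidiagonal_eq_sum_range_succ_mk, blockCount,
        List.length_ofFn]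
    rw [hsum, pow_succ', PowerSeries.coeff_mul]
    refine ⟨integrable_finsetSum _ fun p hp => (key p hp).1, ?_⟩
    rw [integral_finsetSum _ fun p hp => (key p hp).1]
    exact Finset.sum_congr rfl fun p hp => (key p hp).2

/-- The integrated form of the theorem. The weight of a tuple depends only on its weak ascents,
hence is constant on each chamber and leaves the integral. -/
theorem primitive_coeff_log (a : LocIntFun B) {n : ℕ} (hn : 0 < n) {s : ℝ} (hs : 0 < s) :
    primitive (FormalSeries.coeff n (logSeries (nestedSeries a))) s =
      (1 / (n : ℝ)) • ∑ σ : Equiv.Perm (Fin n),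
        ((-1 : ℝ) ^ descents σ / ((n - 1).choose (descents σ) : ℝ)) • permIntegral a.1 σ s := by
  set c : List ℝ → ℝ := fun l =>
    (1 / (n : ℝ)) * ((-1 : ℝ) ^ weakAscents l / ((n - 1).choose (weakAscents l) : ℝ)) with hc
  have hw : (fun v : Fin n → ℝ => c (List.ofFn v) • listProduct a.1 (List.ofFn v)) = fun v =>
      ∑ k ∈ Finset.range n, ((-1 : ℝ) ^ k / ((k : ℝ) + 1)) •
        (blockCount (k + 1) (List.ofFn v) • listProduct a.1 (List.ofFn v)) := by
    funext v
    simp only [smul_smul]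
    rw [← Finset.sum_smul, sum_log_blockCount n hn _ List.length_ofFn]
  have hint : ∀ k ∈ Finset.range n, IntegrableOn (fun v : Fin n → ℝ =>
      ((-1 : ℝ) ^ k / ((k : ℝ) + 1)) •
        (blockCount (k + 1) (List.ofFn v) • listProduct a.1 (List.ofFn v))) (openCube n s) :=
    fun k _ => Integrable.smul ((-1 : ℝ) ^ k / ((k : ℝ) + 1)) (integral_blockCount a (k + 1) n hs).1
  have hci : IntegrableOn (fun v : Fin n → ℝ => c (List.ofFn v) • listProduct a.1 (List.ofFn v))
      (openCube n s) := by
    rw [hw]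
    exact integrable_finsetSum _ hint
  have h1 : primitive (FormalSeries.coeff n (logSeries (nestedSeries a))) s =
      ∫ v in openCube n s, c (List.ofFn v) • listProduct a.1 (List.ofFn v) := by
    rw [hw, integral_finsetSum _ hint, primitive_coeff_logSeries]
    refine Finset.sum_congr rfl fun k _ => ?_
    rw [integral_smul, (integral_blockCount a (k + 1) n hs).2]
  rw [h1, integral_openCube_eq_sum hci, Finset.smul_sum]
  refine Finset.sum_congr rfl fun σ _ => ?_
  rw [smul_smul, permIntegral, ← integral_smul]
  refine setIntegral_congr_fun (measurableSet_simplexDelta n s) fun u hu => ?_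
  simp only [hc, weakAscents_ofFn_comp σ hu.2, permProduct_eq_listProduct]

/-! ### Differentiation in the upper limit. -/

/-- Each `permIntegral` is, for positive times, the primitive of a locally integrable function. -/
theorem exists_primitive_eq_permIntegral (a : LocIntFun B) {n : ℕ} (hn : 0 < n)
    (σ : Equiv.Perm (Fin n)) :
    ∃ g : LocIntFun B, ∀ s, 0 < s → permIntegral a.1 σ s = primitive g s := by
  obtain ⟨n, rfl⟩ := Nat.exists_eq_succ_of_ne_zero hn.ne'
  set g : ℝ → B := fun t => ∫ v in simplexDelta n t, permProduct a.1 σ (Fin.cons t v) with hg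
  have key := fun s => integral_simplexDelta_succ (integrableOn_permProduct a σ s)
  -- Extending by zero to nonpositive times gives local integrability on the whole line: near `x`
  -- only the interval (0, x+1) matters, where Fubini supplies it.
  have hloc : LocallyIntegrable ((Set.Ioi (0 : ℝ)).indicator g) volume := by
    intro x
    refine ⟨Set.Iio (x + 1), Iio_mem_nhds (lt_add_one x), ?_⟩
    rw [integrableOn_indicator_iff measurableSet_Ioi, Set.Ioi_inter_Iio]
    exact (key (x + 1)).1
  refine ⟨⟨_, hloc⟩, fun s hs => ?_⟩
  rw [permIntegral, (key s).2, primitive, intervalIntegral.integral_of_le hs.le,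
    integral_Ioc_eq_integral_Ioo]
  refine setIntegral_congr_fun measurableSet_Ioo fun t ht => ?_
  exact (Set.indicator_of_mem (show t ∈ Set.Ioi (0 : ℝ) from ht.1) g).symm

theorem LocIntFun.ae_hasDerivAt_primitive (g : LocIntFun B) :
    ∀ᵐ s, HasDerivAt (primitive g) (g.1 s) s := by
  filter_upwards [LocallyIntegrable.ae_hasDerivAt_integral g.2] with s hs
  exact hs 0

/-- The half-line is open, so agreement at positive times is agreement near each positive time, and
Lebesgue differentiation applies. -/
theorem LocIntFun.ae_hasDerivAt_of_eq_primitive {F : ℝ → B} {g : LocIntFun B}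
    (h : ∀ s, 0 < s → F s = primitive g s) :
    ∀ᵐ s ∂volume.restrict (Set.Ioi (0 : ℝ)), HasDerivAt F (g.1 s) s := by
  rw [ae_restrict_iff' measurableSet_Ioi]
  filter_upwards [ae_hasDerivAt_primitive g] with s hs h0
  refine hs.congr_of_eventuallyEq ?_
  filter_upwards [Ioi_mem_nhds h0] with t ht
  exact h t ht

theorem ae_hasDerivAt_permIntegral (a : LocIntFun B) {n : ℕ} (hn : 0 < n)
    (σ : Equiv.Perm (Fin n)) :
    ∀ᵐ s ∂volume.restrict (Set.Ioi (0 : ℝ)),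
      HasDerivAt (permIntegral a.1 σ) (permFun a.1 σ s) s := by
  obtain ⟨g, hg⟩ := exists_primitive_eq_permIntegral a hn σ
  filter_upwards [ae_hasDerivAt_of_eq_primitive hg] with s hs
  rw [permFun, hs.deriv]
  exact hs

theorem intervalIntegrable_permFun (a : LocIntFun B) {n : ℕ} (hn : 0 < n)
    (σ : Equiv.Perm (Fin n)) {s : ℝ} (hs : 0 < s) :
    IntervalIntegrable (permFun a.1 σ) volume 0 s := by
  obtain ⟨g, hg⟩ := exists_primitive_eq_permIntegral a hn σ
  refine (g.intervalIntegrable 0 s).congr_ae ?_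
  rw [Set.uIoc_of_le hs.le]
  refine ae_restrict_of_ae_restrict_of_subset (s := Set.Ioc 0 s) (t := Set.Ioi 0)
    Set.Ioc_subset_Ioi_self ?_
  filter_upwards [ae_hasDerivAt_of_eq_primitive hg] with t ht
  rw [permFun, ht.deriv]

/-- Both sides are derivatives of the same function for almost every `s`; finitely many σ add only
finitely many null sets. -/
theorem coeff_log_ae_eq (a : LocIntFun B) {n : ℕ} (hn : 0 < n) :
    (FormalSeries.coeff n (logSeries (nestedSeries a))).1
      =ᵐ[volume.restrict (Set.Ioi (0 : ℝ))] fun s =>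
        (1 / (n : ℝ)) • ∑ σ : Equiv.Perm (Fin n),
          ((-1 : ℝ) ^ descents σ / ((n - 1).choose (descents σ) : ℝ)) • permFun a.1 σ s := by
  have h1 := ae_hasDerivAt_of_eq_primitive fun s hs => (primitive_coeff_log a hn (s := s) hs).symm
  have h2 := ae_all_iff.2 fun σ : Equiv.Perm (Fin n) => ae_hasDerivAt_permIntegral a hn σ
  filter_upwards [h1, h2] with s hs hσ
  refine hs.unique (HasDerivAt.fun_const_smul _ (HasDerivAt.fun_sum fun σ _ => ?_))
  exact (hσ σ).fun_const_smul _

end IteratedIntegralsOfLocIntFun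

end

theorem corollary5p4 {B : Type*} [NormedRing B] [NormedAlgebra ℝ B] [CompleteSpace B]
    (a : LocIntFun B) :
    -- the iterated integrals and the functions `F̃_a(σ)` are well defined
    (∀ (n : ℕ), 0 < n → ∀ σ : Equiv.Perm (Fin n),
      (∀ s : ℝ, 0 < s → IntegrableOn (permProduct a.1 σ) (simplexDelta n s) volume) ∧
      (∀ᵐ s ∂volume.restrict (Set.Ioi (0 : ℝ)), DifferentiableAt ℝ (permIntegral a.1 σ) s) ∧
      (∀ s : ℝ, 0 < s → IntervalIntegrable (permFun a.1 σ) volume 0 s)) ∧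
    -- `X = 𝟏 + λa ≺ X` has a unique solution `X`, its logarithm `Ω` exists and is unique, and
    -- `Ω` has the stated coefficients
    (∃! X : Augmented (FormalSeries (LocIntFun B)),
      Augmented.SolvesLinear (FormalSeries.lam a) X) ∧
    ∀ X : Augmented (FormalSeries (LocIntFun B)),
      Augmented.SolvesLinear (FormalSeries.lam a) X →
      (∃! Ω : FormalSeries (LocIntFun B), Augmented.IsLogStar FormalSeries.filtration X Ω) ∧
      ∀ Ω : FormalSeries (LocIntFun B), Augmented.IsLogStar FormalSeries.filtration X Ω →
        FormalSeries.coeff 0 Ω = 0 ∧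
        ∀ n : ℕ, 0 < n →
          (FormalSeries.coeff n Ω).1 =ᵐ[volume.restrict (Set.Ioi (0 : ℝ))] fun s =>
            (1 / (n : ℝ)) • ∑ σ : Equiv.Perm (Fin n),
              ((-1 : ℝ) ^ descents σ / ((n - 1).choose (descents σ) : ℝ)) • permFun a.1 σ s := by
  refine ⟨fun n hn σ => ⟨fun s _ => integrableOn_permProduct a σ s,
    (ae_hasDerivAt_permIntegral a hn σ).mono fun s hs => hs.differentiableAt,
    fun s hs => intervalIntegrable_permFun a hn σ hs⟩, ?_, fun X hX => ?_⟩
  · simp only [solvesLinear_lam_iff]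
    exact existsUnique_eq
  · rw [solvesLinear_lam_iff] at hX
    subst hX
    have hlog := isLogStar_filtration_iff (X := Augmented.onePlus (nestedSeries a)) rfl rfl
    simp only [hlog]
    refine ⟨existsUnique_eq, ?_⟩
    rintro Ω rfl
    -- In degree zero `logSeries` is an empty sum.
    exact ⟨rfl, fun n hn => coeff_log_ae_eq a hn⟩
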